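/- Let $K$ be a field and let $S$ be a numerical semigroup minimally generated by positive integers $m_1,\dots,m_n$ ($n\ge 1$). Let $k$ be a positive integer with $\gcd(k,m_1)=1$, and let $S_k$ be the $k$-lifting of $S$, i.e. the numerical semigroup generated by $m_1,km_2,\dots,km_n$. Let $R=K[x_1,\dots,x_n]$. The semigroup ring $K[S]=K[t^{m_1},\dots,t^{m_n}]\subseteq K[t]$ is an $R$-module via $x_i\mapsto t^{m_i}$, and $R$ is $S$-graded by $\deg_S(x_i)=m_i$; likewise $K[S_k]$ is an $R$-module and $R$ is $S_k$-graded, using the generators $m_1,km_2,\dots,km_n$. A minimal graded free resolution $({\bf F},\phi)$ of $K[S]$, equipped with a homogeneous basis of each $F_i$, is called *strongly indispensable* if for every minimal graded free resolution $({\bf G},\theta)$ of $K[S]$ equipped with homogeneous bases there is an injective degree-preserving map of complexes $\iota\colon({\bf F},\phi)\to({\bf G},\theta)$, compatible with the augmentations to $K[S]$, which sends every basis element of $F_i$ to a nonzero scalar multiple of a basis element of $G_i$. The same definition applies to $K[S_k]$. Then $K[S_k]$ has a strongly indispensable minimal $S_k$-graded free resolution if and only if $K[S]$ has a strongly indispensable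 minimal $S$-graded free resolution. -/

import Mathlib

/-- `m` is the minimal system of generators of a numerical semigroup `S`: the generators are
positive, the semigroup `S` they generate has finite complement in `ℕ`, and no generator lies in
the semigroup generated by the others. -/
structure MinimallyGeneratesNumericalSemigroup {n : ℕ} (m : Fin n → ℕ) : Prop where
  pos : ∀ i, 0 < m i
  finite_compl : ((AddSubmonoid.closure (Set.range m) : Set ℕ)ᶜ).Finite
  minimal : ∀ i, m i ∉ AddSubmonoid.closure (m '' {i}ᶜ)

/-- The generators `m₁, k m₂, …, k mₙ` of the `k`-lifting `S_k` (the first index is `0`). -/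
def liftGenerators {n : ℕ} (k : ℕ) (m : Fin (n + 1) → ℕ) : Fin (n + 1) → ℕ :=
  fun i => if i = 0 then m 0 else k * m i

/-- The semigroup ring `K[S] = K[t^{m₁}, …, t^{mₙ}] ⊆ K[t]`. -/
noncomputable def semigroupRing (K : Type*) [Field K] {n : ℕ} (m : Fin n → ℕ) :
    Subalgebra K (Polynomial K) :=
  Algebra.adjoin K (Set.range fun i => (Polynomial.X : Polynomial K) ^ m i)

/-- The map `R = K[x₁, …, xₙ] → K[S]`, `xᵢ ↦ t^{mᵢ}`, through which `K[S]` is an `R`-module. -/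
noncomputable def toricMap (K : Type*) [Field K] {n : ℕ} (m : Fin n → ℕ) :
    MvPolynomial (Fin n) K →ₐ[K] semigroupRing K m :=
  MvPolynomial.aeval fun i => ⟨Polynomial.X ^ m i, Algebra.subset_adjoin ⟨i, rfl⟩⟩

/-- A based minimal `S`-graded free resolution
`⋯ → F₂ → F₁ → F₀ → K[S] → 0` over `R = K[x₁, …, xₙ]`, `deg xᵢ = mᵢ`.
The module `Fᵢ = ⨁ⱼ R[-bᵢⱼ]` is written in its homogeneous basis: it is the free module
`Fin (rank i) → R` whose `j`-th standard basis vector has degree `bᵢⱼ = deg i j`. -/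
structure MinimalGradedFreeResolution (K : Type*) [Field K] {n : ℕ} (m : Fin n → ℕ) where
  /-- The Betti numbers. -/
  rank : ℕ → ℕ
  /-- The degrees of the basis elements. -/
  deg : ∀ i, Fin (rank i) → ℕ
  /-- The differentials `Fᵢ₊₁ → Fᵢ`. -/
  d : ∀ i, (Fin (rank (i + 1)) → MvPolynomial (Fin n) K) →ₗ[MvPolynomial (Fin n) K]
    (Fin (rank i) → MvPolynomial (Fin n) K)
  /-- The augmentation `F₀ → K[S]`; being semilinear along `R → K[S]` is being `R`-linear for the
  `R`-module structure of `K[S]`. -/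
  aug : (Fin (rank 0) → MvPolynomial (Fin n) K) →ₛₗ[(toricMap K m).toRingHom]
    semigroupRing K m
  /-- The differentials preserve degrees: the `(l, j)` entry of the matrix of `d i` is homogeneous
  of degree `deg (i + 1) j - deg i l`. -/
  d_homogeneous : ∀ i j l, ∀ u ∈ (d i (Pi.single j 1) l).support,
    Finsupp.weight m u + deg i l = deg (i + 1) j
  /-- The augmentation preserves degrees. -/
  aug_homogeneous : ∀ j, ∃ c : K,
    (aug (Pi.single j 1) : Polynomial K) = Polynomial.monomial (deg 0 j) c
  aug_surjective : Function.Surjective aug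
  exact_zero : Function.Exact (d 0) aug
  exact_succ : ∀ i, Function.Exact (d (i + 1)) (d i)
  /-- Minimality: all entries of the matrices of the differentials lie in `(x₁, …, xₙ)`. -/
  minimal : ∀ i j l, d i (Pi.single j 1) l ∈
    Ideal.span (Set.range (MvPolynomial.X : Fin n → MvPolynomial (Fin n) K))

/-- A based resolution `F` is strongly indispensable if for every based minimal graded free
resolution `G` of `K[S]` there is an injective based map of graded complexes `F → G` over the
identity of `K[S]`: each basis element of `Fᵢ` is sent to a nonzero scalar multiple of a basis
element of `Gᵢ` of the same degree. -/
def MinimalGradedFreeResolution.IsStronglyIndispensable {K : Type*} [Field K] {n : ℕ}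
    {m : Fin n → ℕ} (F : MinimalGradedFreeResolution K m) : Prop :=
  ∀ G : MinimalGradedFreeResolution K m,
    ∃ f : ∀ i, (Fin (F.rank i) → MvPolynomial (Fin n) K) →ₗ[MvPolynomial (Fin n) K]
        (Fin (G.rank i) → MvPolynomial (Fin n) K),
      (∀ i, Function.Injective (f i)) ∧
      (∀ x, G.aug (f 0 x) = F.aug x) ∧
      (∀ i x, G.d i (f (i + 1) x) = f i (F.d i x)) ∧
      ∀ i j, ∃ l, ∃ c : K, c ≠ 0 ∧ G.deg i l = F.deg i j ∧
        f i (Pi.single j 1) = Pi.single l (MvPolynomial.C c)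

/-- `K[S]` has a strongly indispensable minimal free resolution. -/
def HasStronglyIndispensableResolution (K : Type*) [Field K] {n : ℕ} (m : Fin n → ℕ) : Prop :=
  ∃ F : MinimalGradedFreeResolution K m, F.IsStronglyIndispensable

/-! Write φ for the substitution x₀ ↦ x₀ᵏ on R. It makes R free over itself with basis 1, x₀, …,
x₀ᵏ⁻¹. Since gcd(k, m₀) = 1, K[S_k] splits in the same way: it is the direct sum over 0 ≤ r < k of
t^(r m₀) times the copy of K[S] under t ↦ tᵏ. Thus K[S_k] is the base change of K[S] along the flat
map φ, and φ turns minimal resolutions of K[S] into minimal resolutions of K[S_k], multiplying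
degrees by k (`lift`).

Conversely, every minimal graded resolution of K[S_k] arises so (`descend`): by `dvd_deg` all its
basis degrees are multiples of k, which forces the matrix entries to involve x₀ only through x₀ᵏ.
Exactness passes both ways by `Extends.exact_iff`. For strong indispensability, a competing
resolution is carried to the other side, compared there, and the comparison maps are carried back;
they send basis elements to scalar multiples of basis elements, and φ fixes scalars. -/

open MvPolynomial

/-! ### Groups split into k copies of a smaller group, and block maps between them. -/

/-- A decomposition `M = ⨁ᵣ sᵣ (Ψ M')`, `0 ≤ r < k`, with component maps `Φᵣ`. -/
structure CyclicDecomposition (k : ℕ) [NeZero k] (M' M : Type*) [AddCommGroup M']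
    [AddCommGroup M] where
  incl : M' →+ M
  shift : Fin k → M →+ M
  comp : Fin k → M →+ M'
  sum_eq : ∀ x, ∑ r, shift r (incl (comp r x)) = x
  comp_shift_incl : ∀ r q y, comp r (shift q (incl y)) = if r = q then y else 0
  shift_zero : ∀ x, shift 0 x = x

namespace CyclicDecomposition

variable {k : ℕ} [NeZero k] {M' M N' N P' P : Type*} [AddCommGroup M'] [AddCommGroup M]
  [AddCommGroup N'] [AddCommGroup N] [AddCommGroup P'] [AddCommGroup P]

theorem comp_zero_incl (D : CyclicDecomposition k M' M) (y : M') : D.comp 0 (D.incl y) = y := by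
  have := D.comp_shift_incl 0 0 y
  rwa [D.shift_zero, if_pos rfl] at this

theorem incl_injective (D : CyclicDecomposition k M' M) : Function.Injective D.incl :=
  Function.LeftInverse.injective D.comp_zero_incl

theorem eq_zero_of_comp (D : CyclicDecomposition k M' M) {x : M} (h : ∀ r, D.comp r x = 0) :
    x = 0 := by
  rw [← D.sum_eq x]
  simp [h]

theorem eq_shift_of_comp (D : CyclicDecomposition k M' M) {x : M} {r : Fin k}
    (h : ∀ q, q ≠ r → D.comp q x = 0) : x = D.shift r (D.incl (D.comp r x)) := by
  conv_lhs => rw [← D.sum_eq x]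
  refine Finset.sum_eq_single r (fun q _ hq => ?_) (by simp)
  simp [h q hq]

/-- `f` is the extension of `f'` to the decomposed groups. -/
structure Extends (D : CyclicDecomposition k M' M) (E : CyclicDecomposition k N' N)
    (f' : M' → N') (f : M →+ N) : Prop where
  map_incl : ∀ x, f (D.incl x) = E.incl (f' x)
  map_shift : ∀ r x, f (D.shift r x) = E.shift r (f x)

namespace Extends

variable {D : CyclicDecomposition k M' M} {E : CyclicDecomposition k N' N}
  {F : CyclicDecomposition k P' P} {f' : M' → N'} {f : M →+ N} {g' : N' → P'} {g : N →+ P}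

theorem apply_eq (h : D.Extends E f' f) (x : M) :
    f x = ∑ r, E.shift r (E.incl (f' (D.comp r x))) := by
  conv_lhs => rw [← D.sum_eq x, map_sum]
  simp [h.map_shift, h.map_incl]

/-- An extension is block diagonal, with the same block `f'` for every `r`. -/
theorem comp_apply (h : D.Extends E f' f) (r : Fin k) (x : M) :
    E.comp r (f x) = f' (D.comp r x) := by
  rw [h.apply_eq, map_sum]
  simp [E.comp_shift_incl]

theorem map_zero' (h : D.Extends E f' f) : f' 0 = 0 := by
  apply E.incl_injective
  rw [← h.map_incl]
  simp

/-- Together with `unique`, this moves commutative squares between `f'` and `f` in both directions.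
-/
theorem hom_ext {f₁ f₂ : M →+ N} (h₁ : D.Extends E f' f₁) (h₂ : D.Extends E f' f₂) : f₁ = f₂ := by
  ext x
  rw [h₁.apply_eq, h₂.apply_eq]

theorem unique {f₁' f₂' : M' → N'} {f₁ f₂ : M →+ N} (h₁ : D.Extends E f₁' f₁)
    (h₂ : D.Extends E f₂' f₂) (h : ∀ x, f₁ x = f₂ x) : f₁' = f₂' := by
  ext x
  apply E.incl_injective
  rw [← h₁.map_incl, h, h₂.map_incl]

theorem trans (hf : D.Extends E f' f) (hg : E.Extends F g' g) :
    D.Extends F (g' ∘ f') (g.comp f) where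
  map_incl x := by simp [hf.map_incl, hg.map_incl]
  map_shift r x := by simp [hf.map_shift, hg.map_shift]

/-- The sequence of `f`, `g` is k copies of that of `f'`, `g'`, so exactness can be tested on one
block. -/
theorem exact_iff (hf : D.Extends E f' f) (hg : E.Extends F g' g) :
    Function.Exact f g ↔ Function.Exact f' g' := by
  constructor
  · intro H y
    have H' := H (E.incl y)
    rw [hg.map_incl, ← map_zero F.incl, F.incl_injective.eq_iff] at H'
    rw [H']
    constructor
    · rintro ⟨x, hx⟩
      exact ⟨D.comp 0 x, by rw [← hf.comp_apply, hx, E.comp_zero_incl]⟩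
    · rintro ⟨x, rfl⟩
      exact ⟨D.incl x, hf.map_incl x⟩
  · intro H y
    constructor
    · intro hy
      have H' : ∀ r, ∃ x, f' x = E.comp r y := fun r => (H _).1 <| by
        rw [← hg.comp_apply, hy, map_zero]
      choose x hx using H'
      refine ⟨∑ r, D.shift r (D.incl (x r)), ?_⟩
      rw [map_sum]
      simp only [hf.map_shift, hf.map_incl, hx]
      exact E.sum_eq y
    · rintro ⟨x, rfl⟩
      refine F.eq_zero_of_comp fun r => ?_
      rw [hg.comp_apply, hf.comp_apply]
      exact (H _).2 ⟨_, rfl⟩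

theorem surjective_iff (hf : D.Extends E f' f) :
    Function.Surjective f ↔ Function.Surjective f' := by
  constructor
  · intro H y
    obtain ⟨x, hx⟩ := H (E.incl y)
    exact ⟨D.comp 0 x, by rw [← hf.comp_apply, hx, E.comp_zero_incl]⟩
  · intro H y
    choose x hx using fun r => H (E.comp r y)
    refine ⟨∑ r, D.shift r (D.incl (x r)), ?_⟩
    rw [map_sum]
    simp only [hf.map_shift, hf.map_incl, hx]
    exact E.sum_eq y

theorem injective_iff (hf : D.Extends E f' f) :
    Function.Injective f ↔ Function.Injective f' := by
  constructor
  · intro H x y hxy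
    apply D.incl_injective
    apply H
    rw [hf.map_incl, hf.map_incl, hxy]
  · intro H
    rw [injective_iff_map_eq_zero]
    intro x hx
    refine D.eq_zero_of_comp fun r => H ?_
    rw [← hf.comp_apply, hx, map_zero, hf.map_zero']

end Extends

end CyclicDecomposition

/-! ### Division with remainder of the first exponent by k. -/

section Exponents

variable {n : ℕ}

/-- Replace the exponent `a` of the first variable by `k a + r`. -/
noncomputable def stretchExponent (k r : ℕ) (u : Fin (n + 1) →₀ ℕ) : Fin (n + 1) →₀ ℕ :=
  u.update 0 (k * u 0 + r)

/-- Replace the exponent `a` of the first variable by `⌊a / k⌋`. -/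
noncomputable def shrinkExponent (k : ℕ) (u : Fin (n + 1) →₀ ℕ) : Fin (n + 1) →₀ ℕ :=
  u.update 0 (u 0 / k)

@[simp]
theorem stretchExponent_apply_zero (k r : ℕ) (u : Fin (n + 1) →₀ ℕ) :
    stretchExponent k r u 0 = k * u 0 + r := by
  simp [stretchExponent]

theorem shrinkExponent_stretchExponent {k r : ℕ} (hr : r < k) (u : Fin (n + 1) →₀ ℕ) :
    shrinkExponent k (stretchExponent k r u) = u := by
  ext i
  by_cases hi : i = 0
  · subst hi
    simp [shrinkExponent, stretchExponent, Nat.mul_add_div (Nat.zero_lt_of_lt hr),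
      Nat.div_eq_of_lt hr]
  · simp [shrinkExponent, stretchExponent, Function.update_of_ne hi]

theorem stretchExponent_shrinkExponent (k : ℕ) (u : Fin (n + 1) →₀ ℕ) :
    stretchExponent k (u 0 % k) (shrinkExponent k u) = u := by
  ext i
  by_cases hi : i = 0
  · subst hi
    simp [shrinkExponent, stretchExponent, Nat.div_add_mod]
  · simp [shrinkExponent, stretchExponent, Function.update_of_ne hi]

theorem single_add_stretchExponent (k r : ℕ) (u : Fin (n + 1) →₀ ℕ) :
    Finsupp.single 0 r + stretchExponent k 0 u = stretchExponent k r u := by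
  ext i
  by_cases hi : i = 0
  · subst hi
    simp [add_comm]
  · simp [stretchExponent, Function.update_of_ne hi, Ne.symm hi]

theorem stretchExponent_zero (k : ℕ) : stretchExponent k 0 (0 : Fin (n + 1) →₀ ℕ) = 0 := by
  ext i
  by_cases hi : i = 0
  · subst hi
    simp
  · simp [stretchExponent]

/-- Modulo k only `r * m 0` survives, so the degree of a monomial determines the residue of its
first exponent once `m 0` is a unit modulo k. -/
theorem weight_liftGenerators (k r : ℕ) (m : Fin (n + 1) → ℕ) (u : Fin (n + 1) →₀ ℕ) :
    Finsupp.weight (liftGenerators k m) (stretchExponent k r u) =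
      r * m 0 + k * Finsupp.weight m u := by
  rw [Finsupp.weight_apply, Finsupp.weight_apply, Finsupp.sum_fintype _ _ (by simp),
    Finsupp.sum_fintype _ _ (by simp), Fin.sum_univ_succ, Fin.sum_univ_succ, mul_add,
    Finset.mul_sum]
  have h : ∀ i : Fin n, stretchExponent k r u i.succ = u i.succ := fun i => by
    simp [stretchExponent]
  simp only [h, stretchExponent_apply_zero, liftGenerators, Fin.succ_ne_zero, if_true, if_false,
    smul_eq_mul]
  simp only [mul_left_comm k]
  ring

end Exponents

/-! ### Freeness of the polynomial ring along x₀ ↦ x₀ᵏ. -/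

section PolynomialDecomposition

variable (K : Type*) [Field K] {n : ℕ} (k : ℕ)

/-- The endomorphism `x₀ ↦ x₀ᵏ` of `K[x₀, …, xₙ]`. -/
noncomputable def powFirst : MvPolynomial (Fin (n + 1)) K →ₐ[K] MvPolynomial (Fin (n + 1)) K :=
  aeval fun i => if i = 0 then X 0 ^ k else X i

/-- The `r`-th component of a polynomial for the decomposition `⨁ᵣ x₀ʳ K[x₀ᵏ, x₁, …, xₙ]`. -/
noncomputable def powFirstComponent (r : ℕ) :
    MvPolynomial (Fin (n + 1)) K →ₗ[K] MvPolynomial (Fin (n + 1)) K :=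
  (basisMonomials (Fin (n + 1)) K).constr K fun u =>
    if u 0 % k = r then monomial (shrinkExponent k u) 1 else 0

variable {K} {k}

theorem powFirst_monomial (u : Fin (n + 1) →₀ ℕ) (c : K) :
    powFirst K k (monomial u c) = monomial (stretchExponent k 0 u) c := by
  rw [powFirst, aeval_monomial, Finsupp.prod_fintype _ _ (by simp), monomial_eq,
    Finsupp.prod_fintype _ _ (by simp), Fin.prod_univ_succ, Fin.prod_univ_succ]
  have h : ∀ i : Fin n, stretchExponent k 0 u i.succ = u i.succ := fun i => by
    simp [stretchExponent]
  simp [h, Fin.succ_ne_zero, ← pow_mul]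

theorem powFirstComponent_monomial (r : ℕ) (u : Fin (n + 1) →₀ ℕ) (c : K) :
    powFirstComponent K k r (monomial u c) =
      if u 0 % k = r then monomial (shrinkExponent k u) c else 0 := by
  have h : (monomial u c : MvPolynomial (Fin (n + 1)) K) = c • basisMonomials _ K u := by
    simp [smul_monomial]
  rw [h, map_smul, powFirstComponent, Module.Basis.constr_basis]
  split_ifs <;> simp [smul_monomial]

theorem coeff_powFirstComponent {r : ℕ} (hr : r < k) (p : MvPolynomial (Fin (n + 1)) K)
    (u : Fin (n + 1) →₀ ℕ) :
    coeff u (powFirstComponent K k r p) = coeff (stretchExponent k r u) p := by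
  induction p using MvPolynomial.induction_on' with
  | add p q hp hq => simp [hp, hq]
  | monomial v c =>
    rw [powFirstComponent_monomial, coeff_monomial]
    by_cases hv : v = stretchExponent k r u
    · subst hv
      simp [Nat.mod_eq_of_lt hr, shrinkExponent_stretchExponent hr, coeff_monomial]
    · rw [if_neg hv]
      split_ifs with h
      · rw [coeff_monomial, if_neg]
        rintro rfl
        apply hv
        rw [← h, stretchExponent_shrinkExponent]
      · simp

theorem X_pow_mul_powFirst_monomial (r : ℕ) (u : Fin (n + 1) →₀ ℕ) (c : K) :
    X 0 ^ r * powFirst K k (monomial u c) = monomial (stretchExponent k r u) c := by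
  rw [powFirst_monomial, X_pow_eq_monomial, monomial_mul, one_mul, single_add_stretchExponent]

theorem powFirstComponent_X_pow_mul {r q : ℕ} (hq : q < k)
    (p : MvPolynomial (Fin (n + 1)) K) :
    powFirstComponent K k r (X 0 ^ q * powFirst K k p) = if r = q then p else 0 := by
  induction p using MvPolynomial.induction_on' with
  | add p q hp hq =>
    rw [map_add, mul_add, map_add, hp, hq]
    split_ifs <;> simp
  | monomial v c =>
    rw [X_pow_mul_powFirst_monomial, powFirstComponent_monomial,
      shrinkExponent_stretchExponent hq]
    simp [Nat.mod_eq_of_lt hq, eq_comm]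

theorem sum_X_pow_mul_powFirst [NeZero k] (p : MvPolynomial (Fin (n + 1)) K) :
    ∑ r : Fin k, X 0 ^ (r : ℕ) * powFirst K k (powFirstComponent K k r p) = p := by
  induction p using MvPolynomial.induction_on' with
  | add p q hp hq =>
    conv_rhs => rw [← hp, ← hq]
    simp [mul_add, Finset.sum_add_distrib]
  | monomial v c =>
    rw [Finset.sum_eq_single (⟨v 0 % k, Nat.mod_lt _ (NeZero.pos k)⟩ : Fin k)]
    · rw [powFirstComponent_monomial, if_pos rfl, X_pow_mul_powFirst_monomial,
        stretchExponent_shrinkExponent]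
    · intro r _ hr
      rw [powFirstComponent_monomial, if_neg, map_zero, mul_zero]
      intro h
      exact hr (Fin.ext h.symm)
    · simp

variable (K k) in
/-- `K[x₀, …, xₙ] = ⨁ᵣ x₀ʳ K[x₀ᵏ, x₁, …, xₙ]`, coordinatewise on a finite free module. -/
noncomputable def freeDecomposition [NeZero k] (ι : Type*) :
    CyclicDecomposition k (ι → MvPolynomial (Fin (n + 1)) K)
      (ι → MvPolynomial (Fin (n + 1)) K) where
  incl := ((powFirst K k : _ →ₐ[K] MvPolynomial (Fin (n + 1)) K) : _ →+ _).compLeft ι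
  shift r := (AddMonoidHom.mulLeft (X 0 ^ (r : ℕ))).compLeft ι
  comp r := ((powFirstComponent K k r : _ →ₗ[K] MvPolynomial (Fin (n + 1)) K) : _ →+ _).compLeft ι
  sum_eq x := by
    ext1 i
    simpa using sum_X_pow_mul_powFirst (x i)
  comp_shift_incl r q y := by
    ext1 i
    have := powFirstComponent_X_pow_mul (r := r) q.2 (y i)
    simp only [Fin.val_inj] at this
    split_ifs at this ⊢ <;> simpa using this
  shift_zero x := by
    ext1 i
    simp

theorem freeDecomposition_incl_apply [NeZero k] {ι : Type*}
    (x : ι → MvPolynomial (Fin (n + 1)) K) (i : ι) :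
    (freeDecomposition K k ι).incl x i = powFirst K k (x i) := rfl

theorem freeDecomposition_comp_apply [NeZero k] {ι : Type*} (r : Fin k)
    (x : ι → MvPolynomial (Fin (n + 1)) K) (i : ι) :
    (freeDecomposition K k ι).comp r x i = powFirstComponent K k r (x i) := rfl

theorem freeDecomposition_shift [NeZero k] {ι : Type*} (r : Fin k)
    (x : ι → MvPolynomial (Fin (n + 1)) K) :
    (freeDecomposition K k ι).shift r x =
      (X 0 ^ (r : ℕ) : MvPolynomial (Fin (n + 1)) K) • x := rfl

theorem freeDecomposition_incl_smul [NeZero k] {ι : Type*} (a : MvPolynomial (Fin (n + 1)) K)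
    (x : ι → MvPolynomial (Fin (n + 1)) K) :
    (freeDecomposition K k ι).incl (a • x) =
      powFirst K k a • (freeDecomposition K k ι).incl x := by
  ext1 i
  simp [freeDecomposition_incl_apply]

theorem freeDecomposition_incl_single [NeZero k] {ι : Type*} [DecidableEq ι] (i : ι)
    (a : MvPolynomial (Fin (n + 1)) K) :
    (freeDecomposition K k ι).incl (Pi.single i a) = Pi.single i (powFirst K k a) := by
  ext1 j
  rw [freeDecomposition_incl_apply]
  by_cases h : j = i
  · subst h; simp
  · simp [h]

/-- A vector all of whose monomials have first exponent congruent to `r` modulo `k` lies in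
the `r`-th component. -/
theorem eq_smul_incl_of_support [NeZero k] {ι : Type*} {x : ι → MvPolynomial (Fin (n + 1)) K}
    {r : Fin k} (h : ∀ i, ∀ u ∈ (x i).support, u 0 % k = r) :
    x = (X 0 ^ (r : ℕ) : MvPolynomial (Fin (n + 1)) K) •
      (freeDecomposition K k ι).incl ((freeDecomposition K k ι).comp r x) := by
  rw [← freeDecomposition_shift]
  refine (freeDecomposition K k ι).eq_shift_of_comp fun q hq => ?_
  ext i u
  rw [freeDecomposition_comp_apply, coeff_powFirstComponent q.2]
  by_contra hu
  have := h i _ (mem_support_iff.2 hu)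
  rw [stretchExponent_apply_zero, Nat.mul_add_mod, Nat.mod_eq_of_lt q.2] at this
  exact hq (Fin.ext this)

theorem mem_support_powFirst [NeZero k] {p : MvPolynomial (Fin (n + 1)) K}
    {u : Fin (n + 1) →₀ ℕ} (hu : u ∈ (powFirst K k p).support) :
    ∃ v ∈ p.support, stretchExponent k 0 v = u := by
  have hlt := Nat.mod_lt (u 0) (NeZero.pos k)
  -- The coefficient at `u` is read in the component of residue `u 0 % k`; a polynomial in x₀ᵏ has
  -- only the component of residue 0.
  have h := coeff_powFirstComponent hlt (powFirst K k p) (shrinkExponent k u)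
  have h' := powFirstComponent_X_pow_mul (r := u 0 % k) (NeZero.pos k) p
  rw [pow_zero, one_mul] at h'
  rw [stretchExponent_shrinkExponent, h'] at h
  rw [mem_support_iff, ← h] at hu
  split_ifs at hu with h0
  · exact ⟨_, mem_support_iff.2 hu, by rw [← h0, stretchExponent_shrinkExponent]⟩
  · simp at hu

/-- Restates minimality as vanishing of constant terms, which x₀ ↦ x₀ᵏ and the 0-th component both
preserve. -/
theorem mem_span_range_X_iff {σ : Type*} {p : MvPolynomial σ K} :
    p ∈ Ideal.span (Set.range (X : σ → MvPolynomial σ K)) ↔ constantCoeff p = 0 := by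
  rw [← Set.image_univ, mem_ideal_span_X_image, constantCoeff_eq]
  constructor
  · intro h
    by_contra h0
    obtain ⟨i, -, hi⟩ := h 0 (mem_support_iff.2 h0)
    simp at hi
  · intro h u hu
    by_contra! H
    have : u = 0 := by
      ext i
      simpa using H i trivial
    subst this
    exact mem_support_iff.1 hu h

theorem constantCoeff_powFirst [NeZero k] (p : MvPolynomial (Fin (n + 1)) K) :
    constantCoeff (powFirst K k p) = constantCoeff p := by
  have h : (constantCoeff.comp (powFirst K k : _ →ₐ[K] MvPolynomial (Fin (n + 1)) K).toRingHom) =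
      constantCoeff := by
    ext i
    · simp
    · by_cases hi : i = 0 <;> simp [powFirst, hi, NeZero.ne k]
  exact congrArg (fun f => f p) h

theorem constantCoeff_powFirstComponent [NeZero k] (p : MvPolynomial (Fin (n + 1)) K) :
    constantCoeff (powFirstComponent K k 0 p) = constantCoeff p := by
  rw [constantCoeff_eq, coeff_powFirstComponent (NeZero.pos k), stretchExponent_zero]

end PolynomialDecomposition

/-! ### Splitting of K[S_k] by degree modulo k. -/

section SemigroupRing

open MvPolynomial

variable (K : Type*) [Field K]

theorem toricMap_X {n : ℕ} (m : Fin n → ℕ) (i : Fin n) :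
    (toricMap K m (X i) : Polynomial K) = Polynomial.X ^ m i := by
  simp [toricMap]

theorem toricMap_surjective {n : ℕ} (m : Fin n → ℕ) : Function.Surjective (toricMap K m) := by
  have h : ((semigroupRing K m).val.comp (toricMap K m)).range = semigroupRing K m := by
    have : (semigroupRing K m).val.comp (toricMap K m) =
        aeval fun i => (Polynomial.X : Polynomial K) ^ m i := by
      ext i : 1
      simp [toricMap_X]
    rw [this, ← Algebra.adjoin_range_eq_range_aeval]
    rfl
  intro f
  obtain ⟨p, hp⟩ := h.ge f.2
  exact ⟨p, Subtype.ext hp⟩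

variable {K} in
theorem coeff_iterate_divX (a : ℕ) (f : Polynomial K) (i : ℕ) :
    (Polynomial.divX^[a] f).coeff i = f.coeff (i + a) := by
  induction a generalizing f with
  | zero => simp
  | succ a ih =>
    rw [Function.iterate_succ_apply, ih, Polynomial.coeff_divX]
    congr 1

/-- The polynomial whose `i`-th coefficient is the coefficient of `f` in degree `k i + a`. -/
noncomputable def arithmeticPart (k a : ℕ) [NeZero k] : Polynomial K →+ Polynomial K where
  toFun f := Polynomial.contract k (Polynomial.divX^[a] f)
  map_zero' := by
    ext i
    simp [Polynomial.coeff_contract (NeZero.ne k), coeff_iterate_divX]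
  map_add' f g := by
    ext i
    simp [Polynomial.coeff_contract (NeZero.ne k), coeff_iterate_divX]

variable {K}

theorem coeff_arithmeticPart (k a : ℕ) [NeZero k] (f : Polynomial K) (i : ℕ) :
    (arithmeticPart K k a f).coeff i = f.coeff (i * k + a) := by
  rw [← coeff_iterate_divX, ← Polynomial.coeff_contract (NeZero.ne k)]
  rfl

/-- Coprimality makes the k residues r·a distinct, so the summands of K[S_k] do not overlap. -/
theorem eq_of_mul_modEq {k a : ℕ} (h : k.Coprime a) {r q : Fin k} (H : r * a ≡ q * a [MOD k]) :
    r = q := by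
  have := Nat.ModEq.cancel_right_of_coprime h H
  rw [Nat.ModEq, Nat.mod_eq_of_lt r.2, Nat.mod_eq_of_lt q.2] at this
  exact Fin.ext this

theorem arithmeticPart_X_pow_mul_expand {k a : ℕ} [NeZero k] (h : k.Coprime a) (r q : Fin k)
    (g : Polynomial K) :
    arithmeticPart K k (r * a) (Polynomial.X ^ (q * a) * Polynomial.expand K k g) =
      if r = q then g else 0 := by
  ext i
  rw [coeff_arithmeticPart, Polynomial.coeff_X_pow_mul', Polynomial.coeff_expand (NeZero.pos k)]
  by_cases hrq : r = q
  · subst hrq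
    simp [NeZero.pos k]
  · rw [if_neg hrq, Polynomial.coeff_zero]
    split_ifs with h1 h2
    -- A nonzero coefficient would need i·k + r·a ≡ q·a modulo k; `h1` ensures the natural
    -- subtraction in `h2` is not truncated.
    · refine absurd (eq_of_mul_modEq h ?_) hrq
      have := (Nat.modEq_iff_dvd' h1).2 h2
      refine Nat.ModEq.trans ?_ this.symm
      simp [Nat.ModEq]
    · rfl
    · rfl

/-- After x₀ ↦ x₀ᵏ every variable has k times its old degree, which is the effect of t ↦ tᵏ. -/
theorem toricMap_powFirst {n : ℕ} (k : ℕ) (m : Fin (n + 1) → ℕ)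
    (p : MvPolynomial (Fin (n + 1)) K) :
    (toricMap K (liftGenerators k m) (powFirst K k p) : Polynomial K) =
      Polynomial.expand K k (toricMap K m p) := by
  have h : ((semigroupRing K (liftGenerators k m)).val.comp
      (toricMap K (liftGenerators k m))).comp (powFirst K k) =
      ((Polynomial.expand K k).comp (semigroupRing K m).val).comp (toricMap K m) := by
    ext i : 1
    by_cases hi : i = 0
    · subst hi
      simp [powFirst, toricMap_X, liftGenerators, ← pow_mul, mul_comm]
    · simp [powFirst, toricMap_X, liftGenerators, hi, ← pow_mul]
  exact congrArg (fun f => f p) h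

theorem toricMap_eq_sum {n : ℕ} (k : ℕ) [NeZero k] (m : Fin (n + 1) → ℕ)
    (p : MvPolynomial (Fin (n + 1)) K) :
    (toricMap K (liftGenerators k m) p : Polynomial K) =
      ∑ r : Fin k, Polynomial.X ^ (r * m 0) *
        Polynomial.expand K k (toricMap K m (powFirstComponent K k r p)) := by
  conv_lhs => rw [← sum_X_pow_mul_powFirst (k := k) p]
  simp [toricMap_X, toricMap_powFirst, liftGenerators, ← pow_mul, mul_comm]

theorem arithmeticPart_toricMap {n k : ℕ} [NeZero k] {m : Fin (n + 1) → ℕ}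
    (h : k.Coprime (m 0)) (r : Fin k) (p : MvPolynomial (Fin (n + 1)) K) :
    arithmeticPart K k (r * m 0) (toricMap K (liftGenerators k m) p) =
      toricMap K m (powFirstComponent K k r p) := by
  rw [toricMap_eq_sum, map_sum]
  simp [arithmeticPart_X_pow_mul_expand h]

theorem expand_mem_semigroupRing {n : ℕ} (k : ℕ) (m : Fin (n + 1) → ℕ) (f : semigroupRing K m) :
    Polynomial.expand K k f ∈ semigroupRing K (liftGenerators k m) := by
  obtain ⟨p, rfl⟩ := toricMap_surjective K m f
  rw [← toricMap_powFirst]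
  exact Subtype.coe_prop _

/-- Extracting coefficients from `f` corresponds to taking a component of any polynomial that maps
to `f`. -/
theorem arithmeticPart_mem_semigroupRing {n k : ℕ} [NeZero k] {m : Fin (n + 1) → ℕ}
    (h : k.Coprime (m 0)) (r : Fin k) (f : semigroupRing K (liftGenerators k m)) :
    arithmeticPart K k (r * m 0) f ∈ semigroupRing K m := by
  obtain ⟨p, rfl⟩ := toricMap_surjective K _ f
  rw [arithmeticPart_toricMap h]
  exact Subtype.coe_prop _

variable (K) in
/-- `K[S_k] = ⨁ᵣ t^{r m₁} K[kS]`. -/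
noncomputable def semigroupRingDecomposition {n k : ℕ} [NeZero k] {m : Fin (n + 1) → ℕ}
    (h : k.Coprime (m 0)) :
    CyclicDecomposition k (semigroupRing K m) (semigroupRing K (liftGenerators k m)) where
  incl :=
    { toFun := fun f => ⟨Polynomial.expand K k f, expand_mem_semigroupRing k m f⟩
      map_zero' := Subtype.ext (by simp)
      map_add' := fun f g => Subtype.ext (by simp) }
  shift r := AddMonoidHom.mulLeft (toricMap K (liftGenerators k m) (X 0 ^ (r : ℕ)))
  comp r :=
    { toFun := fun f => ⟨arithmeticPart K k (r * m 0) f, arithmeticPart_mem_semigroupRing h r f⟩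
      map_zero' := Subtype.ext (by simp)
      map_add' := fun f g => Subtype.ext (by simp) }
  sum_eq f := by
    obtain ⟨p, rfl⟩ := toricMap_surjective K _ f
    apply Subtype.ext
    conv_rhs => rw [toricMap_eq_sum]
    simp [arithmeticPart_toricMap h, toricMap_X, liftGenerators, ← pow_mul, mul_comm]
  comp_shift_incl r q y := by
    apply Subtype.ext
    have := arithmeticPart_X_pow_mul_expand h r q (y : Polynomial K)
    simp only [AddMonoidHom.coe_mk, ZeroHom.coe_mk, AddMonoidHom.coe_mulLeft, map_pow,
      MulMemClass.coe_mul, SubmonoidClass.coe_pow, toricMap_X, liftGenerators, if_true, ← pow_mul,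
      mul_comm (m 0), this]
    split_ifs <;> rfl
  shift_zero x := by simp

theorem semigroupRingDecomposition_incl {n k : ℕ} [NeZero k] {m : Fin (n + 1) → ℕ}
    (h : k.Coprime (m 0)) (f : semigroupRing K m) :
    ((semigroupRingDecomposition K h).incl f : Polynomial K) = Polynomial.expand K k f := rfl

theorem semigroupRingDecomposition_comp {n k : ℕ} [NeZero k] {m : Fin (n + 1) → ℕ}
    (h : k.Coprime (m 0)) (r : Fin k) (f : semigroupRing K (liftGenerators k m)) :
    ((semigroupRingDecomposition K h).comp r f : Polynomial K) =
      arithmeticPart K k (r * m 0) f := rfl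

theorem semigroupRingDecomposition_shift {n k : ℕ} [NeZero k] {m : Fin (n + 1) → ℕ}
    (h : k.Coprime (m 0)) (r : Fin k) (f : semigroupRing K (liftGenerators k m)) :
    (semigroupRingDecomposition K h).shift r f =
      toricMap K (liftGenerators k m) (X 0 ^ (r : ℕ)) * f := rfl

theorem semigroupRingDecomposition_incl_mul {n k : ℕ} [NeZero k] {m : Fin (n + 1) → ℕ}
    (h : k.Coprime (m 0)) (p : MvPolynomial (Fin (n + 1)) K) (f : semigroupRing K m) :
    (semigroupRingDecomposition K h).incl (toricMap K m p * f) =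
      toricMap K (liftGenerators k m) (powFirst K k p) *
        (semigroupRingDecomposition K h).incl f := by
  apply Subtype.ext
  simp [semigroupRingDecomposition_incl, toricMap_powFirst]

/-- A homogeneous element of `K[S_k]` of degree congruent to `r m₁` modulo `k` lies in the `r`-th
component. -/
theorem eq_shift_incl_of_monomial {n k : ℕ} [NeZero k] {m : Fin (n + 1) → ℕ}
    (h : k.Coprime (m 0)) {r : Fin k} {f : semigroupRing K (liftGenerators k m)} {s : ℕ} {c : K}
    (hf : (f : Polynomial K) = Polynomial.monomial s c) (hs : s ≡ r * m 0 [MOD k]) :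
    f = (semigroupRingDecomposition K h).shift r ((semigroupRingDecomposition K h).incl
      ((semigroupRingDecomposition K h).comp r f)) := by
  refine (semigroupRingDecomposition K h).eq_shift_of_comp fun q hq => Subtype.ext ?_
  ext i
  rw [semigroupRingDecomposition_comp, coeff_arithmeticPart, hf, Polynomial.coeff_monomial,
    if_neg]
  · simp
  · rintro rfl
    refine hq (eq_of_mul_modEq h (Nat.ModEq.trans ?_ hs))
    simp [Nat.ModEq]

end SemigroupRing

/-! ### Extending and contracting linear maps along x₀ ↦ x₀ᵏ. -/

section Extension

open MvPolynomial

/-- The semilinear map with prescribed values on the standard basis. -/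
noncomputable def semilinearOfSingle {ι R A : Type*} [Fintype ι] [CommRing R] [CommRing A] (σ : R →+* A)
    (w : ι → A) : (ι → R) →ₛₗ[σ] A where
  toFun x := ∑ j, σ (x j) * w j
  map_add' x y := by simp [add_mul, Finset.sum_add_distrib]
  map_smul' a x := by simp [Finset.mul_sum, mul_assoc]

theorem semilinearOfSingle_single {ι R A : Type*} [Fintype ι] [DecidableEq ι] [CommRing R] [CommRing A] (σ : R →+* A)
    (w : ι → A) (j : ι) : semilinearOfSingle σ w (Pi.single j 1) = w j := by
  simp only [semilinearOfSingle, LinearMap.coe_mk, AddHom.coe_mk]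
  rw [Finset.sum_eq_single j] <;> simp +contextual

theorem toricMap_semilinear_smul {K : Type*} [Field K] {N : ℕ} {m : Fin N → ℕ} {ι : Type*}
    (f : (ι → MvPolynomial (Fin N) K) →ₛₗ[(toricMap K m).toRingHom] semigroupRing K m)
    (a : MvPolynomial (Fin N) K) (x : ι → MvPolynomial (Fin N) K) :
    f (a • x) = toricMap K m a * f x :=
  f.map_smulₛₗ a x

variable {K : Type*} [Field K] {n k : ℕ} [NeZero k] {ι κ : Type*} [Fintype ι] [DecidableEq ι]

theorem freeDecomposition_incl_eq_sum (x : ι → MvPolynomial (Fin (n + 1)) K) :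
    (freeDecomposition K k ι).incl x =
      ∑ j, powFirst K k (x j) • (Pi.single j 1 : ι → MvPolynomial (Fin (n + 1)) K) := by
  conv_lhs => rw [pi_eq_sum_univ' x]
  rw [map_sum]
  refine Finset.sum_congr rfl fun j _ => ?_
  rw [freeDecomposition_incl_smul]
  congr 1
  have := freeDecomposition_incl_single (K := K) (k := k) (n := n) j 1
  rw [map_one] at this
  convert this using 2

/-- Both composites with `incl` are semilinear along x₀ ↦ x₀ᵏ, so basis vectors suffice. -/
theorem LinearMap.extends_of_single
    {f f' : (ι → MvPolynomial (Fin (n + 1)) K) →ₗ[MvPolynomial (Fin (n + 1)) K]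
      (κ → MvPolynomial (Fin (n + 1)) K)}
    (h : ∀ j, f (Pi.single j 1) = (freeDecomposition K k κ).incl (f' (Pi.single j 1))) :
    (freeDecomposition K k ι).Extends (freeDecomposition K k κ) f' f.toAddMonoidHom where
  map_incl x := by
    rw [LinearMap.toAddMonoidHom_coe, freeDecomposition_incl_eq_sum, map_sum]
    conv_rhs => rw [← (Pi.basisFun (MvPolynomial (Fin (n + 1)) K) ι).sum_repr x, map_sum, map_sum]
    simp [freeDecomposition_incl_smul, h]
  map_shift r x := by
    simp [freeDecomposition_shift]

theorem LinearMap.extends_of_single_semigroupRing {m : Fin (n + 1) → ℕ} (hkm : k.Coprime (m 0))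
    {f : (ι → MvPolynomial (Fin (n + 1)) K) →ₛₗ[(toricMap K (liftGenerators k m)).toRingHom]
      semigroupRing K (liftGenerators k m)}
    {f' : (ι → MvPolynomial (Fin (n + 1)) K) →ₛₗ[(toricMap K m).toRingHom] semigroupRing K m}
    (h : ∀ j, f (Pi.single j 1) =
      (semigroupRingDecomposition K hkm).incl (f' (Pi.single j 1))) :
    (freeDecomposition K k ι).Extends (semigroupRingDecomposition K hkm) f' f.toAddMonoidHom where
  map_incl x := by
    rw [LinearMap.toAddMonoidHom_coe, freeDecomposition_incl_eq_sum, map_sum]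
    conv_rhs => rw [← (Pi.basisFun (MvPolynomial (Fin (n + 1)) K) ι).sum_repr x, map_sum, map_sum]
    refine Finset.sum_congr rfl fun j _ => ?_
    rw [Pi.basisFun_repr, Pi.basisFun_apply, toricMap_semilinear_smul, toricMap_semilinear_smul,
      semigroupRingDecomposition_incl_mul, h]
  map_shift r x := by
    rw [LinearMap.toAddMonoidHom_coe, freeDecomposition_shift, semigroupRingDecomposition_shift,
      toricMap_semilinear_smul]

variable (k) in
/-- The extension of a linear map between free modules along `x₀ ↦ x₀ᵏ`. -/
noncomputable def extendLinear
    (f : (ι → MvPolynomial (Fin (n + 1)) K) →ₗ[MvPolynomial (Fin (n + 1)) K]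
      (κ → MvPolynomial (Fin (n + 1)) K)) :
    (ι → MvPolynomial (Fin (n + 1)) K) →ₗ[MvPolynomial (Fin (n + 1)) K]
      (κ → MvPolynomial (Fin (n + 1)) K) :=
  (Pi.basisFun _ ι).constr (MvPolynomial (Fin (n + 1)) K) fun j =>
    (freeDecomposition K k κ).incl (f (Pi.single j 1))

theorem extendLinear_single
    (f : (ι → MvPolynomial (Fin (n + 1)) K) →ₗ[MvPolynomial (Fin (n + 1)) K]
      (κ → MvPolynomial (Fin (n + 1)) K)) (j : ι) :
    extendLinear k f (Pi.single j 1) = (freeDecomposition K k κ).incl (f (Pi.single j 1)) := by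
  rw [← Pi.basisFun_apply, extendLinear, Module.Basis.constr_basis, Pi.basisFun_apply]

theorem extends_extendLinear
    (f : (ι → MvPolynomial (Fin (n + 1)) K) →ₗ[MvPolynomial (Fin (n + 1)) K]
      (κ → MvPolynomial (Fin (n + 1)) K)) :
    (freeDecomposition K k ι).Extends (freeDecomposition K k κ) f
      (extendLinear k f).toAddMonoidHom :=
  LinearMap.extends_of_single (extendLinear_single f)

variable (k) in
/-- The linear map between free modules whose matrix consists of the components in
`K[x₀ᵏ, x₁, …, xₙ]` of the entries of the matrix of `f`. -/
noncomputable def contractLinear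
    (f : (ι → MvPolynomial (Fin (n + 1)) K) →ₗ[MvPolynomial (Fin (n + 1)) K]
      (κ → MvPolynomial (Fin (n + 1)) K)) :
    (ι → MvPolynomial (Fin (n + 1)) K) →ₗ[MvPolynomial (Fin (n + 1)) K]
      (κ → MvPolynomial (Fin (n + 1)) K) :=
  (Pi.basisFun _ ι).constr (MvPolynomial (Fin (n + 1)) K) fun j =>
    (freeDecomposition K k κ).comp 0 (f (Pi.single j 1))

theorem contractLinear_single
    (f : (ι → MvPolynomial (Fin (n + 1)) K) →ₗ[MvPolynomial (Fin (n + 1)) K]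
      (κ → MvPolynomial (Fin (n + 1)) K)) (j : ι) :
    contractLinear k f (Pi.single j 1) = (freeDecomposition K k κ).comp 0 (f (Pi.single j 1)) := by
  rw [← Pi.basisFun_apply, contractLinear, Module.Basis.constr_basis, Pi.basisFun_apply]

theorem extends_contractLinear
    {f : (ι → MvPolynomial (Fin (n + 1)) K) →ₗ[MvPolynomial (Fin (n + 1)) K]
      (κ → MvPolynomial (Fin (n + 1)) K)}
    (h : ∀ j, f (Pi.single j 1) ∈ Set.range (freeDecomposition K k κ).incl) :
    (freeDecomposition K k ι).Extends (freeDecomposition K k κ) (contractLinear k f)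
      f.toAddMonoidHom :=
  LinearMap.extends_of_single fun j => by
    obtain ⟨y, hy⟩ := h j
    rw [contractLinear_single, ← hy, CyclicDecomposition.comp_zero_incl]

end Extension

/-! ### Divisibility by k of the degrees in a minimal resolution of K[S_k]. -/

namespace MinimalGradedFreeResolution

open MvPolynomial

section Minimality

variable {K : Type*} [Field K] {N : ℕ} {m : Fin N → ℕ} (G : MinimalGradedFreeResolution K m)

theorem constantCoeff_of_mem_range {i : ℕ} {x : Fin (G.rank i) → MvPolynomial (Fin N) K}
    (hx : x ∈ Set.range (G.d i)) (l : Fin (G.rank i)) : constantCoeff (x l) = 0 := by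
  obtain ⟨y, rfl⟩ := hx
  rw [← (Pi.basisFun (MvPolynomial (Fin N) K) _).sum_repr y, map_sum, Finset.sum_apply, map_sum]
  refine Finset.sum_eq_zero fun j _ => ?_
  rw [map_smul, Pi.smul_apply, smul_eq_mul, map_mul, Pi.basisFun_apply,
    mem_span_range_X_iff.1 (G.minimal i j l), mul_zero]

/-- The `j`-th coordinate has constant term 1, whereas boundaries have none by minimality. -/
theorem single_sub_smul_notMem_range {i : ℕ} (j : Fin (G.rank i)) {a : MvPolynomial (Fin N) K}
    (ha : constantCoeff a = 0) (y : Fin (G.rank i) → MvPolynomial (Fin N) K) :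
    Pi.single j 1 - a • y ∉ Set.range (G.d i) := fun h => by
  simpa [ha] using G.constantCoeff_of_mem_range h j

/-- By exactness the cokernel of `d i` embeds in K[S] or in a free module, where `a` acts without
torsion. -/
theorem mem_range_of_smul_mem_range {i : ℕ} {a : MvPolynomial (Fin N) K}
    (ha : toricMap K m a ≠ 0) {x : Fin (G.rank i) → MvPolynomial (Fin N) K}
    (h : a • x ∈ Set.range (G.d i)) : x ∈ Set.range (G.d i) := by
  cases i with
  | zero =>
    refine (G.exact_zero x).1 ((mul_eq_zero.1 ?_).resolve_left ha)
    rw [← toricMap_semilinear_smul]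
    exact (G.exact_zero _).2 h
  | succ i =>
    have h' := (G.exact_succ i _).2 h
    rw [map_smul] at h'
    exact (G.exact_succ i x).1 ((smul_eq_zero.1 h').resolve_left
      fun h0 => ha (by rw [h0, map_zero]))

end Minimality

variable {K : Type*} [Field K] {n k : ℕ} [NeZero k] {m : Fin (n + 1) → ℕ}

theorem exists_modEq_mul {a : ℕ} (h : k.Coprime a) (s : ℕ) :
    ∃ r : Fin k, s ≡ r * a [MOD k] := by
  -- The witness is s/a computed in ℤ/k.
  refine ⟨⟨(s * (a : ZMod k)⁻¹ : ZMod k).val, ZMod.val_lt _⟩, ?_⟩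
  rw [← ZMod.natCast_eq_natCast_iff]
  simp only [Nat.cast_mul, ZMod.natCast_val, ZMod.cast_id', id]
  rw [mul_assoc, mul_comm _ (a : ZMod k), ZMod.coe_mul_inv_eq_one a h.symm, mul_one]

/-- If the degrees in homological degree `i` are divisible by `k`, then an entry of the
differential `d i` has all its monomials in one residue class. -/
theorem support_modEq (hkm : k.Coprime (m 0))
    (G : MinimalGradedFreeResolution K (liftGenerators k m)) {i : ℕ}
    (hi : ∀ l, k ∣ G.deg i l) {j : Fin (G.rank (i + 1))} {r : Fin k}
    (hr : G.deg (i + 1) j ≡ r * m 0 [MOD k]) (l : Fin (G.rank i)) :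
    ∀ u ∈ (G.d i (Pi.single j 1) l).support, u 0 % k = r := by
  intro u hu
  have h := G.d_homogeneous i j l u hu
  rw [← stretchExponent_shrinkExponent k u, weight_liftGenerators] at h
  obtain ⟨c, hc⟩ := hi l
  rw [← h, hc, add_assoc, ← mul_add] at hr
  have := eq_of_mul_modEq hkm (r := ⟨u 0 % k, Nat.mod_lt _ (NeZero.pos k)⟩) (q := r)
    (Nat.ModEq.trans (by simp [Nat.ModEq]) hr)
  exact congrArg Fin.val this

/-- Suppose a basis element e has degree ≡ r m₀ with r ≠ 0. Its image is x₀ʳ times an element which,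
the map being onto or the cokernel torsion-free, is itself the image of some y. Then e - x₀ʳ y is a
cycle, hence a boundary, against minimality. -/
theorem dvd_deg (hkm : k.Coprime (m 0))
    (G : MinimalGradedFreeResolution K (liftGenerators k m)) (i : ℕ) (j : Fin (G.rank i)) :
    k ∣ G.deg i j := by
  have hX : ∀ r : ℕ, toricMap K (liftGenerators k m) (X 0 ^ r) ≠ 0 := fun r h => by
    have := congrArg Subtype.val h
    simp [toricMap_X] at this
  have key : ∀ i j, (∀ r : Fin k, r ≠ 0 → G.deg i j ≡ r * m 0 [MOD k] →
      ∃ y : Fin (G.rank i) → MvPolynomial (Fin (n + 1)) K,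
        Pi.single j 1 - (X 0 ^ (r : ℕ) : MvPolynomial (Fin (n + 1)) K) • y ∈
          Set.range (G.d i)) → k ∣ G.deg i j := by
    intro i j H
    obtain ⟨r, hr⟩ := exists_modEq_mul hkm (G.deg i j)
    by_cases hr0 : r = 0
    · subst hr0
      rw [Fin.val_zero, zero_mul] at hr
      exact (Nat.modEq_zero_iff_dvd).1 hr
    · obtain ⟨y, hy⟩ := H r hr0 hr
      have : (r : ℕ) ≠ 0 := fun h => hr0 (Fin.ext h)
      exact absurd hy (G.single_sub_smul_notMem_range j (by simp [this]) y)
  induction i with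
  | zero =>
    refine key _ j fun r _ hr => ?_
    obtain ⟨c, hc⟩ := G.aug_homogeneous j
    have h := eq_shift_incl_of_monomial hkm hc hr
    rw [semigroupRingDecomposition_shift] at h
    obtain ⟨y, hy⟩ := G.aug_surjective ((semigroupRingDecomposition K hkm).incl
      ((semigroupRingDecomposition K hkm).comp r (G.aug (Pi.single j 1))))
    refine ⟨y, (G.exact_zero _).1 ?_⟩
    rw [map_sub, toricMap_semilinear_smul, hy, ← h, sub_self]
  | succ i hi =>
    refine key _ j fun r _ hr => ?_
    -- By induction the target degrees are multiples of k, so all monomials of the column have first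
    -- exponent ≡ r and x₀ʳ factors out.
    have h := eq_smul_incl_of_support fun l => support_modEq hkm G hi hr l
    obtain ⟨y, hy⟩ := G.mem_range_of_smul_mem_range (hX r) ⟨_, h⟩
    refine ⟨y, (G.exact_succ i _).1 ?_⟩
    rw [map_sub, map_smul, hy, ← h, sub_self]

end MinimalGradedFreeResolution

/-! ### Lifting and descending resolutions and their comparison maps. -/

namespace MinimalGradedFreeResolution

open MvPolynomial

theorem powFirst_C {K : Type*} [Field K] {n k : ℕ} (c : K) : powFirst K k (C c : MvPolynomial (Fin (n + 1)) K) = C c := by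
  rw [← algebraMap_eq, AlgHom.commutes]

variable {K : Type*} [Field K] {n k : ℕ} [NeZero k] {m : Fin (n + 1) → ℕ}

/-- The minimal free resolution of `K[S_k]` obtained from one of `K[S]` by `x₀ ↦ x₀ᵏ`. -/
noncomputable def lift (hkm : k.Coprime (m 0)) (F : MinimalGradedFreeResolution K m) :
    MinimalGradedFreeResolution K (liftGenerators k m) where
  rank := F.rank
  deg i j := k * F.deg i j
  d i := extendLinear k (F.d i)
  aug := semilinearOfSingle _ fun j =>
    (semigroupRingDecomposition K hkm).incl (F.aug (Pi.single j 1))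
  d_homogeneous i j l u hu := by
    rw [extendLinear_single, freeDecomposition_incl_apply] at hu
    obtain ⟨v, hv, rfl⟩ := mem_support_powFirst hu
    rw [weight_liftGenerators, zero_mul, zero_add, ← mul_add, F.d_homogeneous i j l v hv]
  aug_homogeneous j := by
    obtain ⟨c, hc⟩ := F.aug_homogeneous j
    refine ⟨c, ?_⟩
    rw [semilinearOfSingle_single, semigroupRingDecomposition_incl, hc,
      Polynomial.expand_monomial, mul_comm]
  aug_surjective :=
    (LinearMap.extends_of_single_semigroupRing hkm
      (semilinearOfSingle_single _ _)).surjective_iff.2 F.aug_surjective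
  exact_zero := ((extends_extendLinear (F.d 0)).exact_iff
    (LinearMap.extends_of_single_semigroupRing hkm (semilinearOfSingle_single _ _))).2 F.exact_zero
  exact_succ i := ((extends_extendLinear (F.d (i + 1))).exact_iff
    (extends_extendLinear (F.d i))).2 (F.exact_succ i)
  minimal i j l := by
    rw [extendLinear_single, freeDecomposition_incl_apply, mem_span_range_X_iff,
      constantCoeff_powFirst, ← mem_span_range_X_iff]
    exact F.minimal i j l

theorem lift_d_extends (hkm : k.Coprime (m 0)) (F : MinimalGradedFreeResolution K m) (i : ℕ) :
    (freeDecomposition K k _).Extends (freeDecomposition K k _) (F.d i)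
      ((F.lift hkm).d i).toAddMonoidHom :=
  extends_extendLinear (F.d i)

theorem lift_aug_extends (hkm : k.Coprime (m 0)) (F : MinimalGradedFreeResolution K m) :
    (freeDecomposition K k _).Extends (semigroupRingDecomposition K hkm) F.aug
      (F.lift hkm).aug.toAddMonoidHom :=
  LinearMap.extends_of_single_semigroupRing hkm (semilinearOfSingle_single _ _)

/-- Source and target degrees are both divisible by k, so only the residue r = 0 occurs. -/
theorem d_single_mem_range_incl (hkm : k.Coprime (m 0))
    (G : MinimalGradedFreeResolution K (liftGenerators k m)) (i : ℕ) (j : Fin (G.rank (i + 1))) :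
    G.d i (Pi.single j 1) ∈ Set.range (freeDecomposition K k _).incl := by
  have h := eq_smul_incl_of_support (r := 0) fun l =>
    support_modEq hkm G (G.dvd_deg hkm i) (j := j) (r := 0)
      (by simpa using (Nat.modEq_zero_iff_dvd).2 (G.dvd_deg hkm (i + 1) j)) l
  rw [Fin.val_zero, pow_zero, one_smul] at h
  exact ⟨_, h.symm⟩

theorem aug_single_eq_incl (hkm : k.Coprime (m 0))
    (G : MinimalGradedFreeResolution K (liftGenerators k m)) (j : Fin (G.rank 0)) :
    G.aug (Pi.single j 1) = (semigroupRingDecomposition K hkm).incl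
      ((semigroupRingDecomposition K hkm).comp 0 (G.aug (Pi.single j 1))) := by
  obtain ⟨c, hc⟩ := G.aug_homogeneous j
  have h := eq_shift_incl_of_monomial hkm hc (r := 0)
    (by simpa using (Nat.modEq_zero_iff_dvd).2 (G.dvd_deg hkm 0 j))
  rwa [CyclicDecomposition.shift_zero] at h

theorem aug_single_extends (hkm : k.Coprime (m 0))
    (G : MinimalGradedFreeResolution K (liftGenerators k m)) :
    (freeDecomposition K k _).Extends (semigroupRingDecomposition K hkm)
      (semilinearOfSingle (toricMap K m).toRingHom fun j =>
        (semigroupRingDecomposition K hkm).comp 0 (G.aug (Pi.single j 1)))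
      G.aug.toAddMonoidHom :=
  LinearMap.extends_of_single_semigroupRing hkm fun j => by
    rw [semilinearOfSingle_single, ← aug_single_eq_incl]

/-- The minimal free resolution of `K[S]` from which a given one of `K[S_k]` is obtained by
`x₀ ↦ x₀ᵏ`. -/
noncomputable def descend (hkm : k.Coprime (m 0))
    (G : MinimalGradedFreeResolution K (liftGenerators k m)) :
    MinimalGradedFreeResolution K m where
  rank := G.rank
  -- This division is exact by `dvd_deg`.
  deg i j := G.deg i j / k
  d i := contractLinear k (G.d i)
  aug := semilinearOfSingle _ fun j =>
    (semigroupRingDecomposition K hkm).comp 0 (G.aug (Pi.single j 1))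
  d_homogeneous i j l u hu := by
    rw [contractLinear_single, freeDecomposition_comp_apply, mem_support_iff, Fin.val_zero,
      coeff_powFirstComponent (NeZero.pos k)] at hu
    have h := G.d_homogeneous i j l _ (mem_support_iff.2 hu)
    obtain ⟨a, ha⟩ := G.dvd_deg hkm i l
    obtain ⟨b, hb⟩ := G.dvd_deg hkm (i + 1) j
    rw [weight_liftGenerators, zero_mul, zero_add, ha, hb, ← mul_add] at h
    rw [ha, hb, Nat.mul_div_cancel_left _ (NeZero.pos k),
      Nat.mul_div_cancel_left _ (NeZero.pos k)]
    exact Nat.eq_of_mul_eq_mul_left (NeZero.pos k) h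
  aug_homogeneous j := by
    obtain ⟨c, hc⟩ := G.aug_homogeneous j
    obtain ⟨b, hb⟩ := G.dvd_deg hkm 0 j
    refine ⟨c, ?_⟩
    ext i
    rw [semilinearOfSingle_single, semigroupRingDecomposition_comp, coeff_arithmeticPart, hc, hb,
      Nat.mul_div_cancel_left _ (NeZero.pos k), Fin.val_zero, zero_mul, add_zero,
      Polynomial.coeff_monomial, Polynomial.coeff_monomial, mul_comm i]
    simp [NeZero.ne k]
  aug_surjective := (aug_single_extends hkm G).surjective_iff.1 G.aug_surjective
  exact_zero := ((extends_contractLinear (G.d_single_mem_range_incl hkm 0)).exact_iff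
    (aug_single_extends hkm G)).1 G.exact_zero
  exact_succ i := ((extends_contractLinear (G.d_single_mem_range_incl hkm (i + 1))).exact_iff
    (extends_contractLinear (G.d_single_mem_range_incl hkm i))).1 (G.exact_succ i)
  minimal i j l := by
    rw [contractLinear_single, freeDecomposition_comp_apply, mem_span_range_X_iff, Fin.val_zero,
      constantCoeff_powFirstComponent, ← mem_span_range_X_iff]
    exact G.minimal i j l

theorem descend_d_extends (hkm : k.Coprime (m 0))
    (G : MinimalGradedFreeResolution K (liftGenerators k m)) (i : ℕ) :
    (freeDecomposition K k _).Extends (freeDecomposition K k _) ((G.descend hkm).d i)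
      (G.d i).toAddMonoidHom :=
  extends_contractLinear (G.d_single_mem_range_incl hkm i)

theorem descend_aug_extends (hkm : k.Coprime (m 0))
    (G : MinimalGradedFreeResolution K (liftGenerators k m)) :
    (freeDecomposition K k _).Extends (semigroupRingDecomposition K hkm) (G.descend hkm).aug
      G.aug.toAddMonoidHom :=
  aug_single_extends hkm G

/-- `F` is compared with the descent of the competitor `G`; the extended comparison lands in `G`
itself, since `G` extends its descent. -/
theorem IsStronglyIndispensable.lift (hkm : k.Coprime (m 0)) {F : MinimalGradedFreeResolution K m}
    (hF : F.IsStronglyIndispensable) : (F.lift hkm).IsStronglyIndispensable := by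
  intro G
  obtain ⟨f, hinj, haug, hd, hbasis⟩ := hF (G.descend hkm)
  have hf := fun i => extends_extendLinear (k := k) (f i)
  refine ⟨fun i => extendLinear k (f i), fun i => (hf i).injective_iff.2 (hinj i), fun x => ?_,
    fun i x => ?_, fun i j => ?_⟩
  · have h := (hf 0).trans (G.descend_aug_extends hkm)
    rw [show (G.descend hkm).aug ∘ f 0 = F.aug from funext haug] at h
    exact DFunLike.congr_fun (h.hom_ext (F.lift_aug_extends hkm)) x
  · have h := (hf (i + 1)).trans (G.descend_d_extends hkm i)
    rw [show (G.descend hkm).d i ∘ f (i + 1) = f i ∘ F.d i from funext (hd i)] at h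
    exact DFunLike.congr_fun (h.hom_ext ((F.lift_d_extends hkm i).trans (hf i))) x
  · obtain ⟨l, c, hc, hdeg, hl⟩ := hbasis i j
    refine ⟨l, c, hc, ?_, ?_⟩
    · change G.deg i l = k * F.deg i j
      rw [← hdeg]
      exact (Nat.mul_div_cancel' (G.dvd_deg hkm i l)).symm
    · refine (extendLinear_single (f i) j).trans ?_
      rw [hl, freeDecomposition_incl_single, powFirst_C]
      rfl

theorem IsStronglyIndispensable.descend (hkm : k.Coprime (m 0))
    {F : MinimalGradedFreeResolution K (liftGenerators k m)}
    (hF : F.IsStronglyIndispensable) : (F.descend hkm).IsStronglyIndispensable := by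
  intro G
  obtain ⟨f, hinj, haug, hd, hbasis⟩ := hF (G.lift hkm)
  -- Scalars are fixed by x₀ ↦ x₀ᵏ, so the comparison map has its matrix in the image of `incl` and
  -- can be contracted.
  have hincl : ∀ i j, ∃ l, ∃ c : K, c ≠ 0 ∧ (G.lift hkm).deg i l = F.deg i j ∧
      f i (Pi.single j 1) = (freeDecomposition K k _).incl (Pi.single l (C c)) := fun i j => by
    simp only [freeDecomposition_incl_single, powFirst_C]
    exact hbasis i j
  have hf := fun i => extends_contractLinear (k := k) (f := f i) fun j => by
    obtain ⟨l, c, -, -, h⟩ := hincl i j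
    exact ⟨_, h.symm⟩
  refine ⟨fun i => contractLinear k (f i), fun i => (hf i).injective_iff.1 (hinj i), fun x => ?_,
    fun i x => ?_, fun i j => ?_⟩
  · exact congrFun (((hf 0).trans (G.lift_aug_extends hkm)).unique
      (F.descend_aug_extends hkm) haug) x
  · exact congrFun (((hf (i + 1)).trans (G.lift_d_extends hkm i)).unique
      ((F.descend_d_extends hkm i).trans (hf i)) (hd i)) x
  · obtain ⟨l, c, hc, hdeg, hl⟩ := hincl i j
    refine ⟨l, c, hc, ?_, ?_⟩
    · change G.deg i l = F.deg i j / k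
      rw [← hdeg]
      exact (Nat.mul_div_cancel_left _ (NeZero.pos k)).symm
    · refine (contractLinear_single (f i) j).trans ?_
      rw [hl]
      exact CyclicDecomposition.comp_zero_incl _ _

end MinimalGradedFreeResolution

theorem proposition4p2 (K : Type*) [Field K] {n : ℕ} (m : Fin (n + 1) → ℕ)
    (hm : MinimallyGeneratesNumericalSemigroup m) (k : ℕ) (hk : 0 < k)
    (hkm : Nat.Coprime k (m 0)) :
    HasStronglyIndispensableResolution K (liftGenerators k m) ↔
      HasStronglyIndispensableResolution K m := by
  have : NeZero k := ⟨hk.ne'⟩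
  exact ⟨fun ⟨F, hF⟩ => ⟨F.descend hkm, hF.descend hkm⟩, fun ⟨F, hF⟩ => ⟨F.lift hkm, hF.lift hkm⟩⟩
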